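/- Let $a\in\mathbb{R}$ and let $k:[0,\infty)\to(0,\infty)$ be continuous and integrable with $a+\int_0^\infty k(s)\,ds=0$. Put $\lambda(t)=\int_t^\infty k(s)\,ds$ for $t\ge 0$. Suppose that $t\mapsto\log\lambda(t)$ is convex on $[0,\infty)$ and that $\lambda(t)=L(t)\,t^{-\alpha}$ for all $t>0$, where $\alpha\in(0,1)$ and $L:(0,\infty)\to(0,\infty)$ is slowly varying at infinity, i.e. $\lim_{t\to\infty}L(xt)/L(t)=1$ for every $x>0$. Let $r:[0,\infty)\to\mathbb{R}$ be the differential resolvent, i.e. the continuous solution of $$r'(t)=a\,r(t)+\int_0^t k(t-s)\,r(s)\,ds\quad (t\ge 0),\qquad r(0)=1$$ (with the one-sided derivative at $t=0$). Then $$\lim_{t\to\infty} r(t)\,t^{1-\alpha}L(t)=\frac{\sin(\alpha\pi)}{\pi}.$$ In particular, if $\alpha<1/2$, then $r(t)>0$ for all $t\ge0$, $r\in L^2([0,\infty))$ and $r\notin L^1([0,\infty))$. -/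

import Mathlib

open Filter Topology MeasureTheory Set

/-- `L : (0, ∞) → (0, ∞)` is slowly varying at infinity: `L (x t) / L t → 1` as `t → ∞`,
for every `x > 0`. Values of `L` outside `(0, ∞)` play no role. -/
structure IsSlowlyVarying (L : ℝ → ℝ) : Prop where
  pos : ∀ t : ℝ, 0 < t → 0 < L t
  tendsto : ∀ x : ℝ, 0 < x → Tendsto (fun t : ℝ => L (x * t) / L t) atTop (𝓝 1)

/-- The tail integral `λ(t) = ∫_t^∞ k(s) ds` of a kernel `k`. -/
noncomputable def tailIntegral (k : ℝ → ℝ) (t : ℝ) : ℝ :=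
  ∫ s in Ioi t, k s

/-- `r` is a continuous solution on `[0, ∞)` of
`r'(t) = a r(t) + ∫_0^t k(t - s) r(s) ds` for `t ≥ 0`, with `r(0) = 1`.
The derivative is taken within `[0, ∞)`: it is one-sided at `t = 0` and the ordinary
derivative at every `t > 0`. Values of `r` on `(-∞, 0)` play no role. -/
structure IsDifferentialResolvent (a : ℝ) (k r : ℝ → ℝ) : Prop where
  continuousOn : ContinuousOn r (Ici 0)
  initial : r 0 = 1
  hasDeriv : ∀ t : ℝ, 0 ≤ t →
    HasDerivWithinAt r (a * r t + ∫ s in (0 : ℝ)..t, k (t - s) * r s) (Ici 0) t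

/-!
Write `λ` for the tail integral of `k`, `*` for convolution on the half-line, and
`B = π / sin (π α) = ∫_0^1 v ^ (-α) (1 - v) ^ (α - 1) dv`. Since `λ t = L t * t ^ (-α)`, the claim
is `t * λ t * r t → 1 / B`, where `λ` is decreasing and `λ (x t) / λ t → x ^ (-α)`. The proof is purely
real-variable: instead of Laplace transforms and Karamata's Tauberian theorem, the kernel is
deconvolved by the power `t ^ (α - 1)`.

*Monotonicity.* As `a = -λ 0`, integration by parts shows that `R = -r'` solves `R + λ * R = λ`
(`IsDifferentialResolvent.exists_resolvent`). Log-convexity of `λ` forces `R > 0`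
(`pos_of_add_integral_eq`), so `r` decreases; as `λ` decreases too, `∫ R < 1`, that is, `r > 0`.
Integrating the equation for `R` gives `r + λ * r = 1` (`add_vconv_eq_one`), whence
`t * λ t * r t ≤ 1`.

*Asymptotics.* Because `λ` is monotone, a dyadic argument bounds `λ` and `r` by powers
(`exists_rpow_mul_le_of_tendsto`, `exists_le_rpow_mul_of_tendsto`), which supplies the majorants
for every passage to the limit. Dominated convergence gives
`M := t ^ (α - 1) * λ ~ B * t ^ α * λ t` (`tendsto_vconv_rpow_div`). Convolving `r + λ * r = 1` with
`t ^ (α - 1)` gives `M * r ~ t ^ α / α`, and since `M` is slowly varying this yields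
`λ t * ∫_0^t r → 1 / (α B)` (`tendsto_mul_integral`). As `r` is monotone, this can be differentiated
(`tendsto_mul_mul_of_tendsto_mul_integral`).

*Integrability.* For `α < β < 1 / 2` the bound `r t ≤ 1 / (t * λ t) ≤ C * t ^ (β - 1)` gives
`r ∈ L²`, while `r t ≥ c / (t * λ t) ≥ c / (t * λ 0)` at infinity excludes `r ∈ L¹`.
-/

/-! ### Power bounds for monotone regularly varying functions -/

/-- A function that does not decrease under doubling of the argument, and loses at most a factor
`K` within one octave, is almost increasing. -/
theorem le_mul_of_le_comp_two_mul {F : ℝ → ℝ} {K T : ℝ} (hT : 0 < T)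
    (hdbl : ∀ t, T ≤ t → F t ≤ F (2 * t))
    (hloc : ∀ s t, T ≤ s → s ≤ t → t ≤ 2 * s → F s ≤ K * F t) :
    ∀ s t, T ≤ s → s ≤ t → F s ≤ K * F t := by
  have key : ∀ n : ℕ, ∀ s t, T ≤ s → s ≤ t → t ≤ 2 ^ n * s → F s ≤ K * F t := by
    intro n
    induction n with
    | zero => intro s t hs hst ht; exact hloc s t hs hst (by simp at ht; linarith)
    | succ n ih =>
      intro s t hs hst ht
      rcases le_total t (2 * s) with h | h
      · exact hloc s t hs hst h
      · exact (hdbl s hs).trans (ih (2 * s) t (by linarith) h (by rw [pow_succ] at ht; linarith))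
  intro s t hs hst
  have hs0 : 0 < s := hT.trans_le hs
  obtain ⟨n, hn⟩ := pow_unbounded_of_one_lt (t / s) (one_lt_two)
  exact key n s t hs hst ((div_lt_iff₀ hs0).1 hn).le

/-- Lower power bound for a decreasing function `l` of index `-α`: for `β > α`, `t ^ β * l t`
is almost increasing. -/
theorem exists_rpow_mul_le_of_tendsto {l : ℝ → ℝ} {α β : ℝ} (hpos : ∀ t, 0 < l t)
    (hanti : Antitone l) (hβ : 0 < β) (hαβ : α < β)
    (hreg : Tendsto (fun t => l (2 * t) / l t) atTop (𝓝 (2 ^ (-α)))) :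
    ∃ C T, 0 < C ∧ 0 < T ∧ ∀ s t, 0 < s → s ≤ t → T ≤ t → s ^ β * l s ≤ C * (t ^ β * l t) := by
  have h2 : (2 : ℝ) ^ (-β) < 2 ^ (-α) :=
    Real.rpow_lt_rpow_of_exponent_lt one_lt_two (by linarith)
  obtain ⟨T₀, hT₀⟩ := eventually_atTop.1 (hreg.eventually_const_lt h2)
  set T := max T₀ 1 with hTdef
  have hT : 0 < T := lt_of_lt_of_le one_pos (le_max_right _ _)
  have h2β : (2 : ℝ) ^ β * 2 ^ (-β) = 1 := by
    rw [← Real.rpow_add two_pos]; simp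
  have h2β0 : (0 : ℝ) < 2 ^ β := by positivity
  have hdbl' : ∀ t, T ≤ t → l t ≤ 2 ^ β * l (2 * t) := by
    intro t ht
    have := (lt_div_iff₀ (hpos t)).1 (hT₀ t ((le_max_left _ _).trans ht))
    calc l t = 2 ^ β * (2 ^ (-β) * l t) := by rw [← mul_assoc, h2β, one_mul]
      _ ≤ 2 ^ β * l (2 * t) := by gcongr
  have key := le_mul_of_le_comp_two_mul (F := fun t => t ^ β * l t) (K := 2 ^ β) hT
    (by
      intro t ht
      have ht0 : 0 < t := hT.trans_le ht
      calc t ^ β * l t ≤ t ^ β * (2 ^ β * l (2 * t)) := by gcongr; exact hdbl' t ht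
        _ = (2 * t) ^ β * l (2 * t) := by
          rw [Real.mul_rpow two_pos.le ht0.le]; ring)
    (by
      intro s t hs hst ht
      have hs0 : 0 < s := hT.trans_le hs
      calc s ^ β * l s ≤ t ^ β * (2 ^ β * l (2 * s)) :=
            mul_le_mul (Real.rpow_le_rpow hs0.le hst hβ.le) (hdbl' s hs) (hpos s).le
              (by have := hs0.trans_le hst; positivity)
        _ ≤ t ^ β * (2 ^ β * l t) := by
          have := hs0.trans_le hst
          gcongr
          exact hanti ht
        _ = _ := by ring)
  -- The factor `l 0 / l T` extends the bound from `T ≤ s` to all `0 < s`.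
  have hr : 1 ≤ l 0 / l T := (one_le_div (hpos T)).2 (hanti hT.le)
  refine ⟨l 0 / l T * 2 ^ β, T, by have := hpos 0; have := hpos T; positivity, hT, ?_⟩
  intro s t hs hst ht
  have ht0 : 0 < t := hs.trans_le hst
  have hlt := hpos t
  have hlT := hpos T
  have hP : 0 ≤ 2 ^ β * (t ^ β * l t) := by positivity
  rcases le_total T s with h | h
  · calc s ^ β * l s ≤ 2 ^ β * (t ^ β * l t) := key s t h hst
      _ ≤ l 0 / l T * (2 ^ β * (t ^ β * l t)) := le_mul_of_one_le_left hP hr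
      _ = _ := by ring
  · calc s ^ β * l s ≤ T ^ β * l 0 :=
          mul_le_mul (Real.rpow_le_rpow hs.le h hβ.le) (hanti hs.le) (hpos s).le (by positivity)
      _ = l 0 / l T * (T ^ β * l T) := by field_simp
      _ ≤ l 0 / l T * (2 ^ β * (t ^ β * l t)) := by
        have := key T t le_rfl ht
        gcongr
      _ = _ := by ring

/-- Upper power bound for a decreasing function `l` of index `-α`: for `0 < γ < α`, `t ^ γ * l t`
is almost decreasing at infinity. -/
theorem exists_le_rpow_mul_of_tendsto {l : ℝ → ℝ} {α γ : ℝ} (hpos : ∀ t, 0 < l t)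
    (hanti : Antitone l) (hγ : 0 < γ) (hγα : γ < α)
    (hreg : Tendsto (fun t => l (2 * t) / l t) atTop (𝓝 (2 ^ (-α)))) :
    ∃ C T, 0 < C ∧ 0 < T ∧ ∀ s t, T ≤ s → s ≤ t → t ^ γ * l t ≤ C * (s ^ γ * l s) := by
  have h2 : (2 : ℝ) ^ (-α) < 2 ^ (-γ) :=
    Real.rpow_lt_rpow_of_exponent_lt one_lt_two (by linarith)
  obtain ⟨T₀, hT₀⟩ := eventually_atTop.1 (hreg.eventually_lt_const h2)
  set T := max T₀ 1 with hTdef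
  have hT : 0 < T := lt_of_lt_of_le one_pos (le_max_right _ _)
  have h2γ : (2 : ℝ) ^ γ * 2 ^ (-γ) = 1 := by
    rw [← Real.rpow_add two_pos]; simp
  have hp : ∀ t, T ≤ t → 0 < t ^ γ * l t := fun t ht => by
    have := hpos t; have := hT.trans_le ht; positivity
  have key := le_mul_of_le_comp_two_mul (F := fun t => (t ^ γ * l t)⁻¹) (K := 2 ^ γ) hT
    (by
      intro t ht
      have ht0 : 0 < t := hT.trans_le ht
      refine inv_anti₀ (hp _ (by linarith)) ?_
      have := (div_lt_iff₀ (hpos t)).1 (hT₀ t ((le_max_left _ _).trans ht))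
      calc (2 * t) ^ γ * l (2 * t) ≤ (2 * t) ^ γ * (2 ^ (-γ) * l t) := by gcongr
        _ = (2 ^ γ * 2 ^ (-γ)) * (t ^ γ * l t) := by
          rw [Real.mul_rpow two_pos.le ht0.le]; ring
        _ = _ := by rw [h2γ, one_mul])
    (by
      intro s t hs hst ht
      have hs0 : 0 < s := hT.trans_le hs
      have h1 := hp s hs
      have h3 := hp t (hs.trans hst)
      rw [← div_eq_mul_inv, le_div_iff₀ h3, inv_mul_le_iff₀ h1]
      calc t ^ γ * l t ≤ (2 * s) ^ γ * l s :=
            mul_le_mul (Real.rpow_le_rpow (by linarith) ht hγ.le) (hanti hst) (hpos t).le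
              (by positivity)
        _ = _ := by rw [Real.mul_rpow two_pos.le hs0.le]; ring)
  refine ⟨2 ^ γ, T, by positivity, hT, fun s t hs hst => ?_⟩
  have := key s t hs hst
  have h1 := hp s hs
  have h3 := hp t (hs.trans hst)
  rw [← div_eq_mul_inv, le_div_iff₀ h3, inv_mul_le_iff₀ h1] at this
  linarith

/-! ### Beta integrals -/

theorem intervalIntegrable_rpow_mul_one_sub_rpow {u v : ℝ} (hu : -1 < u) (hv : -1 < v) :
    IntervalIntegrable (fun w : ℝ => w ^ u * (1 - w) ^ v) volume 0 1 := by
  have hc := Complex.betaIntegral_convergent (u := ((u + 1 : ℝ) : ℂ)) (v := ((v + 1 : ℝ) : ℂ))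
    (by simp; linarith) (by simp; linarith)
  refine (hc.norm).congr_ae ?_
  rw [uIoc_of_le zero_le_one, ← restrict_Ioo_eq_restrict_Ioc]
  filter_upwards [ae_restrict_mem measurableSet_Ioo] with w hw
  have h1 : (1 : ℂ) - w = ((1 - w : ℝ) : ℂ) := by push_cast; ring
  rw [norm_mul, h1, Complex.norm_cpow_eq_rpow_re_of_pos hw.1,
    Complex.norm_cpow_eq_rpow_re_of_pos (by linarith [hw.2])]
  simp

theorem integral_rpow_neg_mul_one_sub_rpow {α : ℝ} (h0 : 0 < α) (h1 : α < 1) :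
    ∫ w in (0 : ℝ)..1, w ^ (-α) * (1 - w) ^ (α - 1) = Real.pi / Real.sin (Real.pi * α) := by
  have hb := ProbabilityTheory.beta_eq_betaIntegralReal (1 - α) α (by linarith) h0
  have hB : ProbabilityTheory.beta (1 - α) α = Real.pi / Real.sin (Real.pi * α) := by
    rw [ProbabilityTheory.beta, ← Real.Gamma_mul_Gamma_one_sub]
    simp [mul_comm]
  rw [← hB, hb, Complex.betaIntegral]
  have : ∀ w ∈ Ioo (0 : ℝ) 1, (w : ℂ) ^ (((1 - α : ℝ) : ℂ) - 1) * (1 - (w : ℂ)) ^ ((α : ℂ) - 1) =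
      ((w ^ (-α) * (1 - w) ^ (α - 1) : ℝ) : ℂ) := by
    intro w hw
    rw [Complex.ofReal_mul, Complex.ofReal_cpow hw.1.le,
      Complex.ofReal_cpow (by linarith [hw.2])]
    push_cast
    congr 2
    ring
  rw [intervalIntegral.integral_congr_Ioo_of_le zero_le_one this,
    intervalIntegral.integral_ofReal, Complex.ofReal_re]

/-! ### Positivity of the resolvent of a log-convex kernel -/

/-- Log-convexity of `l` says that `l (x + h) / l x` is nondecreasing in `x`. -/
theorem mul_le_mul_of_convexOn_log {l : ℝ → ℝ} (hpos : ∀ t, 0 < l t)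
    (hconv : ConvexOn ℝ (Ici 0) (fun t => Real.log (l t))) {x y h : ℝ}
    (hx : 0 ≤ x) (hxy : x ≤ y) (hh : 0 ≤ h) :
    l (x + h) * l y ≤ l (y + h) * l x := by
  rcases (add_nonneg (sub_nonneg.2 hxy) hh).eq_or_lt with hd | hd
  · have h1 : h = 0 := by linarith
    have h2 : y = x := by linarith
    simp [h1, h2]
  · set d := y - x + h with hd'
    have hy : 0 ≤ y + h := by linarith
    have e1 := hconv.2 (mem_Ici.2 hx) (mem_Ici.2 hy) (show 0 ≤ (y - x) / d from
      by have := sub_nonneg.2 hxy; positivity) (show 0 ≤ h / d from by positivity)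
      (by field_simp; linarith)
    have e2 := hconv.2 (mem_Ici.2 hx) (mem_Ici.2 hy) (show 0 ≤ h / d from by positivity)
      (show 0 ≤ (y - x) / d from by have := sub_nonneg.2 hxy; positivity) (by field_simp; linarith)
    have s1 : ((y - x) / d) • x + (h / d) • (y + h) = x + h := by
      simp only [smul_eq_mul]; field_simp; rw [hd']; ring
    have s2 : (h / d) • x + ((y - x) / d) • (y + h) = y := by
      simp only [smul_eq_mul]; field_simp; rw [hd']; ring
    rw [s1] at e1
    rw [s2] at e2
    simp only [smul_eq_mul] at e1 e2
    have hsum : (y - x) / d + h / d = 1 := by field_simp; linarith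
    have : Real.log (l (x + h)) + Real.log (l y) ≤ Real.log (l (y + h)) + Real.log (l x) := by
      have e3 : (y - x) / d * Real.log (l x) + h / d * Real.log (l (y + h)) +
          (h / d * Real.log (l x) + (y - x) / d * Real.log (l (y + h))) =
          ((y - x) / d + h / d) * (Real.log (l (y + h)) + Real.log (l x)) := by ring
      rw [hsum, one_mul] at e3
      linarith
    rw [← Real.log_mul (hpos _).ne' (hpos _).ne', ← Real.log_mul (hpos _).ne' (hpos _).ne'] at this
    exact (Real.log_le_log_iff (mul_pos (hpos _) (hpos _)) (mul_pos (hpos _) (hpos _))).1 this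

/-- The resolvent `R` of a positive, decreasing, log-convex kernel `l` is positive. At a first
zero `t₀` of `R`, log-convexity compares the equation at `t₀` with the equation at a slightly
earlier time `t` at which `R` is maximal on `[t, t₀]`. -/
theorem pos_of_add_integral_eq {l R : ℝ → ℝ} (hpos : ∀ t, 0 < l t) (hcont : Continuous l)
    (hanti : Antitone l) (hconv : ConvexOn ℝ (Ici 0) (fun t => Real.log (l t)))
    (hR : Continuous R) (heq : ∀ t, 0 ≤ t → R t + ∫ s in (0 : ℝ)..t, l (t - s) * R s = l t) :
    ∀ t, 0 ≤ t → 0 < R t := by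
  by_contra! hcon
  obtain ⟨t', ht'0, ht'⟩ := hcon
  set S : Set ℝ := {t | 0 ≤ t ∧ R t ≤ 0} with hS
  have hSc : IsClosed S :=
    (isClosed_le continuous_const continuous_id).inter (isClosed_le hR continuous_const)
  have hSne : S.Nonempty := ⟨t', ht'0, ht'⟩
  have hSb : BddBelow S := ⟨0, fun t ht => ht.1⟩
  set t₀ := sInf S with ht₀
  obtain ⟨h0, hR0⟩ : t₀ ∈ S := hSc.csInf_mem hSne hSb
  have hlt : ∀ t, 0 ≤ t → t < t₀ → 0 < R t := by
    intro t ht htt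
    by_contra! hc
    exact absurd (csInf_le hSb (show t ∈ S from ⟨ht, hc⟩)) (not_le.2 htt)
  have ht₀pos : 0 < t₀ := by
    rcases h0.eq_or_lt with h | h
    · have := heq 0 le_rfl
      rw [← h] at hR0
      simp at this
      linarith [hpos 0]
    · exact h
  have hl0 := hpos 0
  have hlt₀ := hpos t₀
  -- The comparison below yields `l t₀ ≤ l 0 ^ 2 * (t₀ - t)`, which fails for `t₀ - t ≤ η`, as
  -- `l 0 ^ 2 * η = l t₀ / 2`.
  set η := l t₀ / (2 * l 0 ^ 2) with hη
  have hηpos : 0 < η := by positivity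
  set t₁ := max 0 (t₀ - η) with ht₁
  have ht₁0 : 0 ≤ t₁ := le_max_left _ _
  have ht₁lt : t₁ < t₀ := max_lt ht₀pos (by linarith)
  obtain ⟨t, ⟨htl, htr⟩, hmax⟩ := isCompact_Icc.exists_isMaxOn (nonempty_Icc.2 ht₁lt.le)
    hR.continuousOn
  have hmax' : ∀ s, t₁ ≤ s → s ≤ t₀ → R s ≤ R t := fun s h1 h2 => hmax ⟨h1, h2⟩
  have hRt : 0 < R t := (hlt t₁ ht₁0 ht₁lt).trans_le (hmax' t₁ le_rfl ht₁lt.le)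
  have ht0 : 0 ≤ t := ht₁0.trans htl
  have hint : ∀ u a b, IntervalIntegrable (fun s => l (u - s) * R s) volume a b := fun u a b =>
    (Continuous.mul (by fun_prop) hR).intervalIntegrable _ _
  -- The equation at `t`, compared with the part `[0, t]` of the equation at `t₀`.
  have hA : l t * ∫ s in (0 : ℝ)..t, l (t₀ - s) * R s ≤
      l t₀ * ∫ s in (0 : ℝ)..t, l (t - s) * R s := by
    rw [← intervalIntegral.integral_const_mul, ← intervalIntegral.integral_const_mul]
    refine intervalIntegral.integral_mono_on ht0 ((hint _ _ _).const_mul _)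
      ((hint _ _ _).const_mul _) fun s hs => ?_
    have := mul_le_mul_of_convexOn_log hpos hconv (x := t - s) (y := t) (h := t₀ - t)
      (by linarith [hs.2]) (by linarith [hs.1]) (by linarith)
    have e1 : t - s + (t₀ - t) = t₀ - s := by ring
    have e2 : t + (t₀ - t) = t₀ := by ring
    rw [e1, e2] at this
    have hRs : 0 ≤ R s := by
      rcases hs.2.eq_or_lt with h | h
      · rw [h]; exact hRt.le
      · exact (hlt s hs.1 (by linarith)).le
    nlinarith
  have hB : ∫ s in t..t₀, l (t₀ - s) * R s ≤ (t₀ - t) * (l 0 * R t) := by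
    calc ∫ s in t..t₀, l (t₀ - s) * R s ≤ ∫ s in t..t₀, l 0 * R t := by
          refine intervalIntegral.integral_mono_on htr (hint _ _ _) (by simp) fun s hs => ?_
          calc l (t₀ - s) * R s ≤ l (t₀ - s) * R t := by
                have := (hpos (t₀ - s)).le
                have := hmax' s (htl.trans hs.1) hs.2
                gcongr
            _ ≤ l 0 * R t := by
                have : l (t₀ - s) ≤ l 0 := hanti (by linarith [hs.2])
                gcongr
      _ = _ := by simp; ring
  have hE0 := heq t₀ h0
  have hEt := heq t ht0
  rw [← intervalIntegral.integral_add_adjacent_intervals (hint t₀ 0 t) (hint t₀ t t₀)] at hE0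
  have hC : l t₀ * R t ≤ l t * ((t₀ - t) * (l 0 * R t)) := by
    have hlt' := hpos t
    nlinarith
  have hD : l t₀ ≤ l t * ((t₀ - t) * l 0) := by
    refine le_of_mul_le_mul_right ?_ hRt
    linarith
  have htη : t₀ - t ≤ η := by
    have : t₀ - η ≤ t₁ := le_max_right _ _
    linarith
  have : l t * ((t₀ - t) * l 0) ≤ l 0 * (η * l 0) := by
    have h1 : l t ≤ l 0 := hanti ht0
    have h2 : 0 ≤ t₀ - t := by linarith
    gcongr
  have h3 : l 0 * (η * l 0) = l t₀ / 2 := by rw [hη]; field_simp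
  linarith

/-- The primitive of the resolvent `R` of `l` stays below `1`. -/
theorem integral_lt_one_of_add_integral_eq {l R : ℝ → ℝ} (hpos : ∀ t, 0 < l t)
    (hcont : Continuous l) (hanti : Antitone l) (hR : Continuous R) (hRpos : ∀ t, 0 ≤ t → 0 < R t)
    (heq : ∀ t, 0 ≤ t → R t + ∫ s in (0 : ℝ)..t, l (t - s) * R s = l t) {t : ℝ} (ht : 0 ≤ t) :
    ∫ s in (0 : ℝ)..t, R s < 1 := by
  have h1 : l t * ∫ s in (0 : ℝ)..t, R s ≤ ∫ s in (0 : ℝ)..t, l (t - s) * R s := by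
    rw [← intervalIntegral.integral_const_mul]
    refine intervalIntegral.integral_mono_on ht ((hR.intervalIntegrable _ _).const_mul _)
      ((Continuous.mul (by fun_prop) hR).intervalIntegrable _ _) fun s hs => ?_
    have : l t ≤ l (t - s) := hanti (by linarith [hs.1])
    have := (hRpos s hs.1).le
    gcongr
  have h2 := heq t ht
  have h3 := hRpos t ht
  have h4 := hpos t
  by_contra! hc
  nlinarith

/-! ### The resolvent equation for the tail integral -/

theorem tailIntegral_eq_sub {k : ℝ → ℝ} (hk_int : IntegrableOn k (Ioi 0)) {t : ℝ} (ht : 0 ≤ t) :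
    tailIntegral k t = tailIntegral k 0 - ∫ s in (0 : ℝ)..t, k s := by
  have := intervalIntegral.integral_interval_add_Ioi hk_int (hk_int.mono_set (Ioi_subset_Ioi ht))
  simp only [tailIntegral]
  linarith

/-- For `a = -λ(0)`, the derivative of the differential resolvent `r` is `-R`, where
`R + λ * R = λ`: integrate by parts in `λ * r'`. The truncation `max (t - s) 0`, which has no effect
for `s ≤ t`, makes the kernel continuous on `ℝ`. -/
theorem IsDifferentialResolvent.exists_resolvent {a : ℝ} {k r : ℝ → ℝ}
    (hk_cont : ContinuousOn k (Ici 0)) (hk_int : IntegrableOn k (Ioi 0))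
    (ha : a + ∫ s in Ioi (0 : ℝ), k s = 0) (hr : IsDifferentialResolvent a k r) :
    ∃ R : ℝ → ℝ, Continuous R ∧ (∀ t, 0 ≤ t → ∫ s in (0 : ℝ)..t, R s = 1 - r t) ∧
      ∀ t, 0 ≤ t → R t + ∫ s in (0 : ℝ)..t, tailIntegral k (max (t - s) 0) * R s =
        tailIntegral k t := by
  have ha' : a = -tailIntegral k 0 := by rw [tailIntegral]; linarith
  set K : ℝ → ℝ := fun t => k (max t 0) with hK
  set ρ : ℝ → ℝ := fun t => r (max t 0) with hρ
  have hKc : Continuous K :=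
    hk_cont.comp_continuous (by fun_prop) fun t => mem_Ici.2 (le_max_right _ _)
  have hρc : Continuous ρ :=
    hr.continuousOn.comp_continuous (by fun_prop) fun t => mem_Ici.2 (le_max_right _ _)
  have hρ0 : ∀ t, 0 ≤ t → ρ t = r t := fun t ht => by simp [hρ, max_eq_left ht]
  have hK0 : ∀ t, 0 ≤ t → K t = k t := fun t ht => by simp [hK, max_eq_left ht]
  set R : ℝ → ℝ := fun t => tailIntegral k 0 * ρ t - ∫ s in (0 : ℝ)..t, K (t - s) * ρ s with hRdef
  have hRc : Continuous R := by
    refine (hρc.const_mul _).sub ?_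
    exact intervalIntegral.continuous_parametric_intervalIntegral_of_continuous
      (f := fun t s => K (t - s) * ρ s) (by simp only [Function.uncurry_def]; fun_prop)
      continuous_id
  have hRr : ∀ t, 0 ≤ t →
      R t = -(a * r t + ∫ s in (0 : ℝ)..t, k (t - s) * r s) := by
    intro t ht
    have : ∫ s in (0 : ℝ)..t, K (t - s) * ρ s = ∫ s in (0 : ℝ)..t, k (t - s) * r s := by
      refine intervalIntegral.integral_congr fun s hs => ?_
      rw [uIcc_of_le ht] at hs
      rw [hK0 _ (by linarith [hs.2]), hρ0 _ hs.1]
    simp only [hRdef]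
    rw [this, hρ0 t ht, ha']
    ring
  have hder : ∀ t, 0 < t → HasDerivAt ρ (-R t) t := by
    intro t ht
    have h1 : HasDerivAt r (-R t) t := by
      rw [hRr t ht.le, neg_neg]
      exact (hr.hasDeriv t ht.le).hasDerivAt (Ici_mem_nhds ht)
    refine h1.congr_of_eventuallyEq ?_
    filter_upwards [lt_mem_nhds ht] with s hs using hρ0 s hs.le
  set l : ℝ → ℝ := fun t => tailIntegral k 0 - ∫ s in (0 : ℝ)..t, K s with hl
  have hlder : ∀ t, HasDerivAt l (-K t) t := fun t =>
    (intervalIntegral.integral_hasDerivAt_right (hKc.intervalIntegrable _ _)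
      (hKc.stronglyMeasurableAtFilter _ _) hKc.continuousAt).const_sub _
  have hl0 : ∀ t, 0 ≤ t → l t = tailIntegral k t := by
    intro t ht
    rw [tailIntegral_eq_sub hk_int ht]
    simp only [hl]
    congr 1
    refine intervalIntegral.integral_congr fun s hs => ?_
    rw [uIcc_of_le ht] at hs
    exact hK0 s hs.1
  have hlc : Continuous l := continuous_iff_continuousAt.2 fun t => (hlder t).continuousAt
  refine ⟨R, hRc, fun t ht => ?_, fun t ht => ?_⟩
  · have := intervalIntegral.integral_eq_sub_of_hasDerivAt_of_le ht hρc.continuousOn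
      (fun s hs => hder s hs.1) (hRc.neg.intervalIntegrable _ _)
    rw [intervalIntegral.integral_neg, hρ0 t ht, hρ0 0 le_rfl, hr.initial] at this
    linarith
  · have hparts := intervalIntegral.integral_mul_deriv_eq_deriv_mul_of_hasDerivAt
      (a := 0) (b := t) (u := fun s => l (t - s)) (v := ρ) (u' := fun s => K (t - s))
      (v' := fun s => -R s) (by fun_prop) hρc.continuousOn
      (fun s _ => by simpa using (hlder (t - s)).comp_const_sub t s)
      (fun s hs => hder s (by rw [min_eq_left ht] at hs; exact hs.1))
      (Continuous.intervalIntegrable (by fun_prop) _ _)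
      (Continuous.intervalIntegrable (by fun_prop) _ _)
    have e1 : ∫ s in (0 : ℝ)..t, tailIntegral k (max (t - s) 0) * R s =
        ∫ s in (0 : ℝ)..t, l (t - s) * R s := by
      refine intervalIntegral.integral_congr fun s hs => ?_
      rw [uIcc_of_le ht] at hs
      have : 0 ≤ t - s := by linarith [hs.2]
      rw [max_eq_left this, hl0 _ this]
    have e2 : ∫ s in (0 : ℝ)..t, l (t - s) * -R s = -∫ s in (0 : ℝ)..t, l (t - s) * R s := by
      rw [← intervalIntegral.integral_neg]
      simp
    rw [e2] at hparts
    simp only [sub_self, sub_zero, hl0 t ht, hl0 0 le_rfl, hρ0 0 le_rfl, hr.initial, mul_one]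
      at hparts
    rw [e1]
    have : R t = tailIntegral k 0 * ρ t - ∫ s in (0 : ℝ)..t, K (t - s) * ρ s := rfl
    linarith

/-! ### Convolution on the half-line -/

/-- The convolution `∫_0^t f(s) g(t - s) ds` on the half-line. -/
noncomputable def vconv (f g : ℝ → ℝ) (t : ℝ) : ℝ :=
  ∫ s in (0 : ℝ)..t, f s * g (t - s)

/-- The restriction of `f` to `(0, ∞)`, extended by zero to `ℝ` with values in `[0, ∞]`. Under this
map, `vconv` becomes convolution on `ℝ`, for which Tonelli's theorem gives associativity. -/
noncomputable def posPart₀ (f : ℝ → ℝ) : ℝ → ENNReal :=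
  (Ioi 0).indicator fun t => ENNReal.ofReal (f t)

theorem vconv_comm (f g : ℝ → ℝ) (t : ℝ) : vconv f g t = vconv g f t := by
  have := intervalIntegral.integral_comp_sub_left (a := 0) (b := t)
    (fun s => g s * f (t - s)) t
  simp only [sub_self, sub_zero, sub_sub_cancel] at this
  rw [vconv, vconv, ← this]
  exact intervalIntegral.integral_congr fun s _ => mul_comm _ _

theorem lconvolution_posPart₀ (f g : ℝ → ℝ) (hf : ∀ t, 0 < t → 0 ≤ f t) {t : ℝ} :
    (lconvolution (posPart₀ f) (posPart₀ g) volume) t =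
      ∫⁻ s in Ioo 0 t, ENNReal.ofReal (f s * g (t - s)) := by
  rw [lconvolution_def, ← lintegral_indicator measurableSet_Ioo]
  congr 1
  ext y
  simp only [posPart₀, indicator, mem_Ioi, mem_Ioo]
  by_cases h1 : 0 < y
  · by_cases h2 : y < t
    · rw [if_pos h1, if_pos (by linarith), if_pos ⟨h1, h2⟩, ENNReal.ofReal_mul (hf y h1)]
      congr 3
      ring
    · rw [if_neg (c := 0 < -y + t) (by linarith), if_neg (c := 0 < y ∧ y < t) (fun h => h2 h.2),
        mul_zero]
  · rw [if_neg h1, if_neg (c := 0 < y ∧ y < t) (fun h => h1 h.1), zero_mul]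

theorem ofReal_vconv {f g : ℝ → ℝ} (hf : ∀ t, 0 < t → 0 ≤ f t) (hg : ∀ t, 0 < t → 0 ≤ g t)
    {t : ℝ} (ht : 0 ≤ t) (hint : IntervalIntegrable (fun s => f s * g (t - s)) volume 0 t) :
    ENNReal.ofReal (vconv f g t) = (lconvolution (posPart₀ f) (posPart₀ g) volume) t := by
  rw [lconvolution_posPart₀ f g hf, vconv, intervalIntegral.integral_of_le ht,
    integral_Ioc_eq_integral_Ioo, ofReal_integral_eq_lintegral_ofReal]
  · exact ((intervalIntegrable_iff_integrableOn_Ioo_of_le ht).1 hint)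
  · filter_upwards [ae_restrict_mem measurableSet_Ioo] with s hs
    exact mul_nonneg (hf s hs.1) (hg _ (by linarith [hs.2]))

theorem vconv_eq_toReal {f g : ℝ → ℝ} (hf : ∀ t, 0 < t → 0 ≤ f t) (hg : ∀ t, 0 < t → 0 ≤ g t)
    (hfm : Measurable (posPart₀ f)) (hgm : Measurable (posPart₀ g)) {t : ℝ} (ht : 0 ≤ t) :
    vconv f g t = ((lconvolution (posPart₀ f) (posPart₀ g) volume) t).toReal := by
  rw [lconvolution_posPart₀ f g hf, vconv, intervalIntegral.integral_of_le ht,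
    integral_Ioc_eq_integral_Ioo, integral_eq_lintegral_of_nonneg_ae]
  · filter_upwards [ae_restrict_mem measurableSet_Ioo] with s hs
    exact mul_nonneg (hf s hs.1) (hg _ (by linarith [hs.2]))
  · have : Measurable fun s => (posPart₀ f s * posPart₀ g (t - s)).toReal := by fun_prop
    refine this.aestronglyMeasurable.congr ?_
    filter_upwards [ae_restrict_mem measurableSet_Ioo] with s hs
    have h2 : t - s ∈ Ioi (0 : ℝ) := by simpa using hs.2
    rw [posPart₀, posPart₀, indicator_of_mem (mem_Ioi.2 hs.1), indicator_of_mem h2,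
      ENNReal.toReal_mul, ENNReal.toReal_ofReal (hf s hs.1), ENNReal.toReal_ofReal (hg _ h2)]

theorem vconv_nonneg {f g : ℝ → ℝ} (hf : ∀ t, 0 < t → 0 ≤ f t) (hg : ∀ t, 0 < t → 0 ≤ g t)
    {t : ℝ} (ht : 0 ≤ t) : 0 ≤ vconv f g t := by
  rw [vconv, intervalIntegral.integral_of_le ht, integral_Ioc_eq_integral_Ioo]
  exact setIntegral_nonneg measurableSet_Ioo fun s hs =>
    mul_nonneg (hf s hs.1) (hg _ (by linarith [hs.2]))

theorem posPart₀_vconv {f g : ℝ → ℝ} (hf : ∀ t, 0 < t → 0 ≤ f t) (hg : ∀ t, 0 < t → 0 ≤ g t)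
    (hint : ∀ t, 0 < t → IntervalIntegrable (fun s => f s * g (t - s)) volume 0 t) :
    posPart₀ (vconv f g) = lconvolution (posPart₀ f) (posPart₀ g) volume := by
  ext t
  rcases le_or_gt t 0 with ht | ht
  · rw [lconvolution_posPart₀ f g hf, Ioo_eq_empty (by linarith), posPart₀,
      indicator_of_notMem (by simpa using ht)]
    simp
  · rw [← ofReal_vconv hf hg ht.le (hint t ht), posPart₀, indicator_of_mem (mem_Ioi.2 ht)]

theorem measurable_posPart₀ {f : ℝ → ℝ} (hf : Measurable f) : Measurable (posPart₀ f) :=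
  (ENNReal.measurable_ofReal.comp hf).indicator measurableSet_Ioi

/-- Associativity for nonnegative functions. Integrability is needed for the inner convolutions
only, as the outer integrals have the same junk value when infinite. -/
theorem vconv_assoc {f g h : ℝ → ℝ} (hf : ∀ t, 0 < t → 0 ≤ f t) (hg : ∀ t, 0 < t → 0 ≤ g t)
    (hh : ∀ t, 0 < t → 0 ≤ h t) (hfm : Measurable f) (hgm : Measurable g) (hhm : Measurable h)
    (hfg : ∀ t, 0 < t → IntervalIntegrable (fun s => f s * g (t - s)) volume 0 t)
    (hgh : ∀ t, 0 < t → IntervalIntegrable (fun s => g s * h (t - s)) volume 0 t)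
    {t : ℝ} (ht : 0 ≤ t) :
    vconv (vconv f g) h t = vconv f (vconv g h) t := by
  have hfm' := measurable_posPart₀ hfm
  have hgm' := measurable_posPart₀ hgm
  have hhm' := measurable_posPart₀ hhm
  rw [vconv_eq_toReal (fun t ht => vconv_nonneg hf hg ht.le) hh _ hhm' ht,
    vconv_eq_toReal hf (fun t ht => vconv_nonneg hg hh ht.le) hfm' _ ht,
    posPart₀_vconv hf hg hfg, posPart₀_vconv hg hh hgh, lconvolution_assoc hfm' hgm' hhm']
  · rw [posPart₀_vconv hg hh hgh]; exact measurable_lconvolution volume hgm' hhm'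
  · rw [posPart₀_vconv hf hg hfg]; exact measurable_lconvolution volume hfm' hgm'

theorem intervalIntegrable_vconv {f g : ℝ → ℝ} (hf : Continuous f) (hg : Continuous g) (t : ℝ) :
    IntervalIntegrable (fun s => f s * g (t - s)) volume 0 t :=
  Continuous.intervalIntegrable (by fun_prop) _ _

/-- Rescaling the variable of integration to `[0, 1]`. -/
theorem vconv_eq_mul_integral (f g : ℝ → ℝ) (t : ℝ) :
    vconv f g t = t * ∫ v in (0 : ℝ)..1, f (t * v) * g (t * (1 - v)) := by
  have := intervalIntegral.smul_integral_comp_mul_left (a := 0) (b := 1)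
    (fun s => f s * g (t - s)) t
  simp only [mul_zero, mul_one, smul_eq_mul] at this
  rw [vconv, ← this]
  congr 1
  refine intervalIntegral.integral_congr fun v _ => ?_
  simp only [mul_sub, mul_one]

/-- If `R` is the resolvent of `l`, then `r = 1 - ∫ R` solves `r + l * r = 1`. -/
theorem add_vconv_eq_one {l R r : ℝ → ℝ} (hpos : ∀ t, 0 < l t) (hcont : Continuous l)
    (hR : Continuous R) (hRpos : ∀ t, 0 ≤ t → 0 < R t)
    (heq : ∀ t, 0 ≤ t → R t + vconv l R t = l t)
    (hr : ∀ t, 0 ≤ t → ∫ s in (0 : ℝ)..t, R s = 1 - r t) {t : ℝ} (ht : 0 ≤ t) :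
    r t + vconv l r t = 1 := by
  have hR1 : ∀ t, 0 ≤ t → vconv R (fun _ => 1) t = 1 - r t := fun t ht => by
    simp [vconv, hr t ht]
  have hassoc := vconv_assoc (f := l) (g := R) (h := fun _ => 1) (fun t _ => (hpos t).le)
    (fun t h => (hRpos t h.le).le) (fun _ _ => zero_le_one) hcont.measurable hR.measurable
    measurable_const (fun t _ => intervalIntegrable_vconv hcont hR t)
    (fun t _ => intervalIntegrable_vconv hR continuous_const t) ht
  have e1 : vconv (vconv l R) (fun _ => 1) t =
      (∫ s in (0 : ℝ)..t, l s) - ∫ s in (0 : ℝ)..t, R s := by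
    rw [vconv, ← intervalIntegral.integral_sub (hcont.intervalIntegrable _ _)
      (hR.intervalIntegrable _ _)]
    refine intervalIntegral.integral_congr fun s hs => ?_
    rw [uIcc_of_le ht] at hs
    have := heq s hs.1
    simp only [mul_one]
    linarith
  have hcl : ContinuousOn (fun s => 1 - ∫ x in (0 : ℝ)..s, R x) univ :=
    (continuous_const.sub (intervalIntegral.continuous_primitive
      (fun a b => hR.intervalIntegrable a b) 0)).continuousOn
  have hcr : Continuous (fun s => 1 - ∫ x in (0 : ℝ)..s, R x) := by
    simpa [continuousOn_univ] using hcl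
  have e2 : vconv l (vconv R fun _ => 1) t = (∫ s in (0 : ℝ)..t, l s) - vconv l r t := by
    have e3 : vconv l r t = ∫ s in (0 : ℝ)..t, l s * (1 - ∫ x in (0 : ℝ)..(t - s), R x) := by
      refine intervalIntegral.integral_congr fun s hs => ?_
      rw [uIcc_of_le ht] at hs
      rw [hr _ (by linarith [hs.2])]
      ring
    rw [e3, vconv, ← intervalIntegral.integral_sub (hcont.intervalIntegrable _ _)
      (Continuous.intervalIntegrable (by fun_prop) _ _)]
    refine intervalIntegral.integral_congr fun s hs => ?_
    rw [uIcc_of_le ht] at hs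
    have h0 : 0 ≤ t - s := by linarith [hs.2]
    rw [hR1 _ h0, hr _ h0]
    ring
  rw [e1, e2, hr t ht] at hassoc
  linarith

/-! ### Asymptotics of the resolvent -/

/-- Integrable majorant, uniform in `t > 0`, for the rescaled kernel `v ↦ l (t v) / l t`. -/
theorem exists_div_le_rpow_neg {l : ℝ → ℝ} {α β : ℝ} (hpos : ∀ t, 0 < l t)
    (hanti : Antitone l) (hβ : 0 < β) (hαβ : α < β)
    (hreg : Tendsto (fun t => l (2 * t) / l t) atTop (𝓝 (2 ^ (-α)))) :
    ∃ C, 0 < C ∧ ∀ t v, 0 < t → 0 < v → v ≤ 1 → l (t * v) / l t ≤ C * v ^ (-β) := by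
  obtain ⟨C, T, hC, hT, h⟩ := exists_rpow_mul_le_of_tendsto hpos hanti hβ hαβ hreg
  have hl0 := hpos 0
  have hlT := hpos T
  refine ⟨C + l 0 / l T, by positivity, fun t v ht hv hv1 => ?_⟩
  have hlt := hpos t
  have hvβ : 1 ≤ v ^ (-β) := Real.one_le_rpow_of_pos_of_le_one_of_nonpos hv hv1 (by linarith)
  have hq : 0 < l 0 / l T := by positivity
  rcases le_total T t with hTt | hTt
  · have h1 := h (t * v) t (by positivity) (mul_le_of_le_one_right ht.le hv1) hTt
    rw [Real.mul_rpow ht.le hv.le] at h1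
    have h2 : v ^ β * l (t * v) ≤ C * l t := by
      have : 0 < t ^ β := by positivity
      refine le_of_mul_le_mul_left ?_ this
      linarith
    have h3 : l (t * v) / l t ≤ C * v ^ (-β) := by
      rw [div_le_iff₀ hlt, Real.rpow_neg hv.le, ← div_eq_mul_inv, div_mul_eq_mul_div,
        le_div_iff₀ (by positivity)]
      linarith
    have : 0 ≤ l 0 / l T * v ^ (-β) := by positivity
    linarith
  · have h1 : l (t * v) / l t ≤ l 0 / l T :=
      div_le_div₀ hl0.le (hanti (by positivity)) hlT (hanti hTt)
    have h2 : l 0 / l T ≤ l 0 / l T * v ^ (-β) := le_mul_of_one_le_right hq.le hvβ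
    have : 0 ≤ C * v ^ (-β) := by positivity
    linarith

theorem ae_uIoc_of_forall_mem_Ioo {p : ℝ → Prop} (hp : ∀ v ∈ Ioo (0 : ℝ) 1, p v) :
    ∀ᵐ v ∂volume, v ∈ uIoc (0 : ℝ) 1 → p v := by
  filter_upwards [compl_mem_ae_iff.2 (measure_singleton (1 : ℝ))] with v hv hv'
  rw [uIoc_of_le zero_le_one] at hv'
  exact hp v ⟨hv'.1, lt_of_le_of_ne hv'.2 hv⟩

theorem measurable_vconv {f g : ℝ → ℝ} (hf : Measurable f) (hg : Measurable g) :
    Measurable (vconv f g) := by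
  have h : vconv f g = fun t => t * ∫ v in Ioc (0 : ℝ) 1, f (t * v) * g (t * (1 - v)) := by
    ext t
    rw [vconv_eq_mul_integral, intervalIntegral.integral_of_le zero_le_one]
  rw [h]
  refine measurable_id.mul (StronglyMeasurable.measurable ?_)
  refine StronglyMeasurable.integral_prod_right
    (f := fun t v => f (t * v) * g (t * (1 - v))) (Measurable.stronglyMeasurable ?_)
  simp only [Function.uncurry_def]
  fun_prop

theorem intervalIntegrable_rpow_mul_comp_sub {l : ℝ → ℝ} {α : ℝ} (hα : 0 < α) (hl : Continuous l)
    (t : ℝ) : IntervalIntegrable (fun s => s ^ (α - 1) * l (t - s)) volume 0 t :=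
  (intervalIntegral.intervalIntegrable_rpow' (by linarith)).mul_continuousOn (by fun_prop)

theorem vconv_rpow_div_eq {l : ℝ → ℝ} {α t : ℝ} (ht : 0 < t) (hlt : 0 < l t) :
    vconv (fun s => s ^ (α - 1)) l t / (t ^ α * l t) =
      ∫ v in (0 : ℝ)..1, l (t * v) / l t * (1 - v) ^ (α - 1) := by
  have e1 : (∫ v in (0 : ℝ)..1, l (t * v) * (t * (1 - v)) ^ (α - 1)) =
      ∫ v in (0 : ℝ)..1, t ^ (α - 1) * l t * (l (t * v) / l t * (1 - v) ^ (α - 1)) := by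
    refine intervalIntegral.integral_congr fun v hv => ?_
    rw [uIcc_of_le zero_le_one] at hv
    have : (t * (1 - v)) ^ (α - 1) = t ^ (α - 1) * (1 - v) ^ (α - 1) :=
      Real.mul_rpow ht.le (by linarith [hv.2])
    simp only [this]
    field_simp
  rw [vconv_comm, vconv_eq_mul_integral, e1, intervalIntegral.integral_const_mul,
    Real.rpow_sub_one ht.ne']
  field_simp

/-- Abelian half: the convolution of `t ^ (α - 1)` with a decreasing kernel `l` of index `-α` is
asymptotic to `π / sin (π α) * t ^ α * l t`, and the ratio is bounded on `(0, ∞)`. -/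
theorem tendsto_vconv_rpow_div {l : ℝ → ℝ} {α : ℝ} (hpos : ∀ t, 0 < l t) (hcont : Continuous l)
    (hanti : Antitone l) (hα : 0 < α) (hα1 : α < 1)
    (hreg : ∀ x, 0 < x → Tendsto (fun t => l (x * t) / l t) atTop (𝓝 (x ^ (-α)))) :
    Tendsto (fun t => vconv (fun s => s ^ (α - 1)) l t / (t ^ α * l t)) atTop
        (𝓝 (Real.pi / Real.sin (Real.pi * α))) ∧
      ∃ C, 0 < C ∧ ∀ t, 0 < t → |vconv (fun s => s ^ (α - 1)) l t / (t ^ α * l t)| ≤ C := by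
  obtain ⟨C, hC, hb⟩ := exists_div_le_rpow_neg (β := (α + 1) / 2) hpos hanti (by linarith)
    (by linarith) (hreg 2 two_pos)
  set β := (α + 1) / 2 with hβ
  have hbound : ∀ t, 0 < t → ∀ v ∈ Ioo (0 : ℝ) 1,
      ‖l (t * v) / l t * (1 - v) ^ (α - 1)‖ ≤ C * (v ^ (-β) * (1 - v) ^ (α - 1)) := by
    intro t ht v hv
    have h1 : 0 < 1 - v := by linarith [hv.2]
    have h2 := hpos t
    have h3 := hpos (t * v)
    rw [Real.norm_of_nonneg (by positivity), ← mul_assoc]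
    gcongr
    exact hb t v ht hv.1 hv.2.le
  have hint : IntervalIntegrable (fun v : ℝ => C * (v ^ (-β) * (1 - v) ^ (α - 1))) volume 0 1 :=
    (intervalIntegrable_rpow_mul_one_sub_rpow (by linarith) (by linarith)).const_mul C
  constructor
  · rw [← integral_rpow_neg_mul_one_sub_rpow hα hα1]
    have : Tendsto (fun t => ∫ v in (0 : ℝ)..1, l (t * v) / l t * (1 - v) ^ (α - 1)) atTop
        (𝓝 (∫ v in (0 : ℝ)..1, v ^ (-α) * (1 - v) ^ (α - 1))) := by
      refine intervalIntegral.tendsto_integral_filter_of_dominated_convergence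
        (fun v : ℝ => C * (v ^ (-β) * (1 - v) ^ (α - 1))) ?_ ?_ hint ?_
      · exact Eventually.of_forall fun t => Measurable.aestronglyMeasurable (by fun_prop)
      · filter_upwards [eventually_gt_atTop 0] with t ht
        exact ae_uIoc_of_forall_mem_Ioo (hbound t ht)
      · refine ae_uIoc_of_forall_mem_Ioo fun v hv => ?_
        have := hreg v hv.1
        simp only [mul_comm v] at this
        exact this.mul_const _
    refine this.congr' ?_
    filter_upwards [eventually_gt_atTop 0] with t ht using (vconv_rpow_div_eq ht (hpos t)).symm
  · refine ⟨|∫ v in (0 : ℝ)..1, C * (v ^ (-β) * (1 - v) ^ (α - 1))| + 1, by positivity,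
      fun t ht => ?_⟩
    rw [vconv_rpow_div_eq ht (hpos t), ← Real.norm_eq_abs]
    have := intervalIntegral.norm_integral_le_abs_of_norm_le (a := 0) (b := 1) (μ := volume)
      (f := fun v => l (t * v) / l t * (1 - v) ^ (α - 1))
      (g := fun v : ℝ => C * (v ^ (-β) * (1 - v) ^ (α - 1))) (by
        rw [uIoc_of_le zero_le_one, ← restrict_Ioo_eq_restrict_Ioc]
        filter_upwards [ae_restrict_mem measurableSet_Ioo] with v hv using hbound t ht v hv) hint
    linarith

/-- A priori bound: by monotonicity, `t * l t * r t ≤ (l * r) t ≤ 1`. -/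
theorem mul_mul_le_one {l r : ℝ → ℝ} (hpos : ∀ t, 0 < l t) (hcont : Continuous l)
    (hanti : Antitone l) (hrc : Continuous r) (hr0 : ∀ t, 0 ≤ r t) (hra : Antitone r)
    (heq : ∀ t, 0 ≤ t → r t + vconv l r t = 1) {t : ℝ} (ht : 0 ≤ t) : t * (l t * r t) ≤ 1 := by
  have h1 : t * (l t * r t) ≤ vconv l r t := by
    calc t * (l t * r t) = ∫ _ in (0 : ℝ)..t, l t * r t := by
          rw [intervalIntegral.integral_const, smul_eq_mul, sub_zero]
      _ ≤ vconv l r t := by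
        refine intervalIntegral.integral_mono_on ht (by simp) (intervalIntegrable_vconv hcont hrc t)
          fun s hs => ?_
        exact mul_le_mul (hanti hs.2) (hra (by linarith [hs.1])) (hr0 _) (hpos _).le
  linarith [heq t ht, hr0 t]

/-- The a priori bound and the lower power bound for `l` make `r` decay like a power. -/
theorem exists_le_rpow_of_mul_mul_le_one {l r : ℝ → ℝ} {α β : ℝ} (hpos : ∀ t, 0 < l t)
    (hanti : Antitone l) (hβ : 0 < β) (hαβ : α < β)
    (hreg : Tendsto (fun t => l (2 * t) / l t) atTop (𝓝 (2 ^ (-α))))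
    (hle : ∀ t, 0 ≤ t → t * (l t * r t) ≤ 1) :
    ∃ C T, 0 < T ∧ ∀ t, T ≤ t → r t ≤ C * t ^ (β - 1) := by
  obtain ⟨C, T, hC, hT, h⟩ := exists_rpow_mul_le_of_tendsto hpos hanti hβ hαβ hreg
  have hlT := hpos T
  refine ⟨C / (T ^ β * l T), T, hT, fun t ht => ?_⟩
  have ht0 := hT.trans_le ht
  have hlt := hpos t
  have h1 := h T t hT ht ht
  have h2 := hle t ht0.le
  have h3 : r t ≤ 1 / (t * l t) := by
    rw [le_div_iff₀ (by positivity)]; linarith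
  refine h3.trans ?_
  rw [div_mul_eq_mul_div, div_le_div_iff₀ (by positivity) (by positivity)]
  have e : t ^ (β - 1) * t = t ^ β := by rw [Real.rpow_sub_one ht0.ne']; field_simp
  calc 1 * (T ^ β * l T) ≤ C * (t ^ β * l t) := by linarith
    _ = C * t ^ (β - 1) * (t * l t) := by rw [← e]; ring

/-- Integrable majorant for the rescaled resolvent `v ↦ t * l t * r (t v)`. -/
theorem exists_mul_mul_comp_le {l r : ℝ → ℝ} {α γ : ℝ} (hpos : ∀ t, 0 < l t)
    (hanti : Antitone l) (hγ : 0 < γ) (hγα : γ < α) (hα1 : α < 1)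
    (hreg : Tendsto (fun t => l (2 * t) / l t) atTop (𝓝 (2 ^ (-α))))
    (hr0 : ∀ t, 0 ≤ r t) (hr1 : ∀ t, r t ≤ 1) (hle : ∀ t, 0 ≤ t → t * (l t * r t) ≤ 1) :
    ∃ C T, 0 < C ∧ 0 < T ∧ ∀ t v, T ≤ t → 0 < v → v ≤ 1 →
      t * l t * r (t * v) ≤ C * v ^ (γ - 1) := by
  obtain ⟨C, T, hC, hT, h⟩ := exists_le_rpow_mul_of_tendsto hpos hanti hγ hγα hreg
  have hlT := hpos T
  refine ⟨C * (1 + T * l T), T, by positivity, hT, fun t v ht hv hv1 => ?_⟩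
  have ht0 := hT.trans_le ht
  have hlt := hpos t
  set s := t * v with hs
  have hs0 : 0 < s := by positivity
  have hst : s ≤ t := mul_le_of_le_one_right ht0.le hv1
  have hls := hpos s
  have hrs := hr0 s
  have esplit : ∀ x : ℝ, 0 < x → x ^ γ * x ^ (1 - γ) = x := fun x hx => by
    rw [← Real.rpow_add hx]; simp
  -- In both cases `t ^ γ * l t` is compared with its value at `max s T`.
  have hkey : t ^ γ * l t * (r s * s ^ (1 - γ)) ≤ C * (1 + T * l T) := by
    rcases le_total T s with hTs | hTs
    · calc t ^ γ * l t * (r s * s ^ (1 - γ)) ≤ C * (s ^ γ * l s) * (r s * s ^ (1 - γ)) := by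
            have := h s t hTs hst
            gcongr
        _ = C * ((s ^ γ * s ^ (1 - γ)) * (l s * r s)) := by ring
        _ ≤ C * 1 := by rw [esplit s hs0]; have := hle s hs0.le; gcongr
        _ ≤ C * (1 + T * l T) := by
          have : 0 ≤ T * l T := by positivity
          gcongr; linarith
    · calc t ^ γ * l t * (r s * s ^ (1 - γ)) ≤ C * (T ^ γ * l T) * (1 * T ^ (1 - γ)) := by
            have h1 := h T t le_rfl ht
            have h2 := hr1 s
            have h3 : s ^ (1 - γ) ≤ T ^ (1 - γ) := Real.rpow_le_rpow hs0.le hTs (by linarith)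
            gcongr
        _ = C * ((T ^ γ * T ^ (1 - γ)) * l T) := by ring
        _ ≤ C * (1 + T * l T) := by rw [esplit T hT]; gcongr; linarith
  have hvs : v ^ (γ - 1) = t ^ (1 - γ) / s ^ (1 - γ) := by
    rw [hs, Real.mul_rpow ht0.le hv.le, show γ - 1 = -(1 - γ) by ring, Real.rpow_neg hv.le]
    field_simp
  rw [hvs, ← mul_div_assoc, le_div_iff₀ (by positivity)]
  calc t * l t * r s * s ^ (1 - γ) = t ^ γ * t ^ (1 - γ) * l t * r s * s ^ (1 - γ) := by
        rw [esplit t ht0]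
    _ = t ^ (1 - γ) * (t ^ γ * l t * (r s * s ^ (1 - γ))) := by ring
    _ ≤ t ^ (1 - γ) * (C * (1 + T * l T)) := by gcongr
    _ = _ := by ring

/-- Tauberian half: the primitive of the resolvent satisfies `l t * ∫_0^t r → 1 / (α B)` with
`B = π / sin (π α)`. Convolving `r + l * r = 1` with `t ^ (α - 1)` and rescaling to `[0, 1]` gives
`∫ m_t ρ_t → 1 / α`, where `ρ_t` is the rescaled resolvent and `m_t → B` pointwise by the Abelian
half; power majorants for `m_t` and `ρ_t` allow `m_t` to be replaced by `B`. -/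
theorem tendsto_mul_integral {l r : ℝ → ℝ} {α : ℝ} (hpos : ∀ t, 0 < l t) (hcont : Continuous l)
    (hanti : Antitone l) (hα : 0 < α) (hα1 : α < 1)
    (hreg : ∀ x, 0 < x → Tendsto (fun t => l (x * t) / l t) atTop (𝓝 (x ^ (-α))))
    (hrc : Continuous r) (hr0 : ∀ t, 0 ≤ r t) (hr1 : ∀ t, r t ≤ 1) (hra : Antitone r)
    (heq : ∀ t, 0 ≤ t → r t + vconv l r t = 1) :
    Tendsto (fun t => l t * ∫ s in (0 : ℝ)..t, r s) atTop
      (𝓝 (1 / (α * (Real.pi / Real.sin (Real.pi * α))))) := by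
  have hsin : 0 < Real.sin (Real.pi * α) :=
    Real.sin_pos_of_pos_of_lt_pi (by positivity) (by nlinarith [Real.pi_pos])
  set B := Real.pi / Real.sin (Real.pi * α) with hB
  have hBpos : 0 < B := div_pos Real.pi_pos hsin
  have hle : ∀ t, 0 ≤ t → t * (l t * r t) ≤ 1 := fun t ht =>
    mul_mul_le_one hpos hcont hanti hrc hr0 hra heq ht
  have hβ : (0 : ℝ) < (α + 1) / 2 := by linarith
  have hαβ : α < (α + 1) / 2 := by linarith
  have hγ : (0 : ℝ) < α / 2 := by linarith
  have hγα : α / 2 < α := by linarith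
  obtain ⟨C₁, hC₁, hl⟩ := exists_div_le_rpow_neg hpos hanti hβ hαβ (hreg 2 two_pos)
  obtain ⟨C₂, T, hC₂, hT, hρ⟩ := exists_mul_mul_comp_le hpos hanti hγ hγα hα1 (hreg 2 two_pos)
    hr0 hr1 hle
  obtain ⟨C₃, T', hT', hrT⟩ := exists_le_rpow_of_mul_mul_le_one hpos hanti hβ hαβ
    (hreg 2 two_pos) hle
  obtain ⟨hMlim, C₄, hC₄, hM⟩ := tendsto_vconv_rpow_div hpos hcont hanti hα hα1 hreg
  set M := vconv (fun s => s ^ (α - 1)) l with hMdef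
  set β := (α + 1) / 2 with hβdef
  set γ := α / 2 with hγdef
  have hMm : Measurable M := measurable_vconv (by fun_prop) hcont.measurable
  have hrlim : Tendsto r atTop (𝓝 0) := by
    have h1 : Tendsto (fun t : ℝ => C₃ * t ^ (β - 1)) atTop (𝓝 (C₃ * 0)) := by
      have := (tendsto_rpow_neg_atTop (y := 1 - β) (by linarith)).const_mul C₃
      simpa using this
    rw [mul_zero] at h1
    exact squeeze_zero' (Eventually.of_forall hr0)
      ((eventually_ge_atTop T').mono fun t ht => hrT t ht) h1
  have hrlim' : ∀ v ∈ Ioo (0 : ℝ) 1, Tendsto (fun t => r (t * (1 - v))) atTop (𝓝 0) := fun v hv =>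
    hrlim.comp (tendsto_id.atTop_mul_const (by linarith [hv.2]))
  set m : ℝ → ℝ → ℝ := fun t v => M (t * v) / (t ^ α * l t) with hm
  set ρ : ℝ → ℝ → ℝ := fun t v => t * l t * r (t * (1 - v)) with hρdef
  -- The equation `M * r = t ^ (α - 1) * (1 - r)`, rescaled.
  have hscaled : ∀ t, 0 < t → ∫ v in (0 : ℝ)..1, m t v * ρ t v =
      ∫ v in (0 : ℝ)..1, v ^ (α - 1) * (1 - r (t * (1 - v))) := by
    intro t ht
    have hlt := hpos t
    have h1 : vconv M r t = vconv (fun s => s ^ (α - 1)) (vconv l r) t :=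
      vconv_assoc (fun s hs => by positivity) (fun s _ => (hpos s).le) (fun s _ => hr0 s)
        (by fun_prop) hcont.measurable hrc.measurable
        (fun s _ => intervalIntegrable_rpow_mul_comp_sub hα hcont s)
        (fun s _ => intervalIntegrable_vconv hcont hrc s) ht.le
    have h2 : vconv (fun s => s ^ (α - 1)) (vconv l r) t =
        vconv (fun s => s ^ (α - 1)) (fun s => 1 - r s) t := by
      refine intervalIntegral.integral_congr fun s hs => ?_
      rw [uIcc_of_le ht.le] at hs
      have := heq (t - s) (by linarith [hs.2])
      simp only
      congr 1
      linarith
    rw [h2, vconv_eq_mul_integral, vconv_eq_mul_integral] at h1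
    have h3 := mul_left_cancel₀ ht.ne' h1
    have h4 : ∫ v in (0 : ℝ)..1, M (t * v) * r (t * (1 - v)) =
        t ^ (α - 1) * ∫ v in (0 : ℝ)..1, m t v * ρ t v := by
      rw [← intervalIntegral.integral_const_mul]
      refine intervalIntegral.integral_congr fun v _ => ?_
      simp only [hm, hρdef]
      rw [Real.rpow_sub_one ht.ne']
      have : 0 < t ^ α := by positivity
      field_simp
    have h5 : ∫ v in (0 : ℝ)..1, (t * v) ^ (α - 1) * (1 - r (t * (1 - v))) =
        t ^ (α - 1) * ∫ v in (0 : ℝ)..1, v ^ (α - 1) * (1 - r (t * (1 - v))) := by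
      rw [← intervalIntegral.integral_const_mul]
      refine intervalIntegral.integral_congr fun v hv => ?_
      rw [uIcc_of_le zero_le_one] at hv
      rw [Real.mul_rpow ht.le hv.1, mul_assoc]
    rw [h4, h5] at h3
    exact mul_left_cancel₀ (by positivity) h3
  have hlim1 : Tendsto (fun t => ∫ v in (0 : ℝ)..1, m t v * ρ t v) atTop (𝓝 (1 / α)) := by
    have e : ∫ v in (0 : ℝ)..1, v ^ (α - 1) * (1 - 0) = 1 / α := by
      simp only [sub_zero, mul_one]
      rw [integral_rpow (Or.inl (by linarith))]
      simp [hα.ne']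
    rw [← e]
    have : Tendsto (fun t => ∫ v in (0 : ℝ)..1, v ^ (α - 1) * (1 - r (t * (1 - v)))) atTop
        (𝓝 (∫ v in (0 : ℝ)..1, v ^ (α - 1) * (1 - 0))) := by
      refine intervalIntegral.tendsto_integral_filter_of_dominated_convergence
        (fun v : ℝ => v ^ (α - 1)) ?_ ?_
        (intervalIntegral.intervalIntegrable_rpow' (by linarith)) ?_
      · exact Eventually.of_forall fun t => Measurable.aestronglyMeasurable (by fun_prop)
      · refine Eventually.of_forall fun t => ae_uIoc_of_forall_mem_Ioo fun v hv => ?_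
        have h1 := hr0 (t * (1 - v))
        have h2 := hr1 (t * (1 - v))
        have h3 : 0 < v ^ (α - 1) := Real.rpow_pos_of_pos hv.1 _
        rw [Real.norm_of_nonneg (mul_nonneg h3.le (by linarith))]
        exact mul_le_of_le_one_right h3.le (by linarith)
      · exact ae_uIoc_of_forall_mem_Ioo fun v hv => ((hrlim' v hv).const_sub 1).const_mul _
    refine this.congr' ?_
    filter_upwards [eventually_gt_atTop 0] with t ht using (hscaled t ht).symm
  have hm_eq : ∀ t v, 0 < t → 0 < v →
      m t v = v ^ α * (l (t * v) / l t) * (M (t * v) / ((t * v) ^ α * l (t * v))) := by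
    intro t v ht hv
    have h1 := hpos t
    have h2 := hpos (t * v)
    simp only [hm]
    rw [Real.mul_rpow ht.le hv.le]
    have : 0 < t ^ α := by positivity
    have : 0 < v ^ α := by positivity
    field_simp
  have hm_le : ∀ t v, 0 < t → v ∈ Ioo (0 : ℝ) 1 → |m t v| ≤ C₁ * C₄ * v ^ (α - β) := by
    intro t v ht hv
    have hv0 := hv.1
    have h1 := hl t v ht hv0 hv.2.le
    have h2 := hM (t * v) (by positivity)
    have h3 := hpos t
    have h4 := hpos (t * v)
    rw [hm_eq t v ht hv0, abs_mul, abs_of_nonneg (by positivity)]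
    calc v ^ α * (l (t * v) / l t) * |M (t * v) / ((t * v) ^ α * l (t * v))|
        ≤ v ^ α * (C₁ * v ^ (-β)) * C₄ := by gcongr
      _ = C₁ * C₄ * (v ^ α * v ^ (-β)) := by ring
      _ = _ := by rw [← Real.rpow_add hv0, sub_eq_add_neg]
  have hm_lim : ∀ v ∈ Ioo (0 : ℝ) 1, Tendsto (fun t => m t v) atTop (𝓝 B) := by
    intro v hv
    have h1 : Tendsto (fun t => v ^ α * (l (t * v) / l t) *
        (M (t * v) / ((t * v) ^ α * l (t * v)))) atTop (𝓝 (v ^ α * v ^ (-α) * B)) := by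
      have h2 := hreg v hv.1
      simp only [mul_comm v] at h2
      exact (h2.const_mul _).mul (hMlim.comp (tendsto_id.atTop_mul_const hv.1))
    rw [← Real.rpow_add hv.1, add_neg_cancel, Real.rpow_zero, one_mul] at h1
    refine h1.congr' ?_
    filter_upwards [eventually_gt_atTop 0] with t ht using (hm_eq t v ht hv.1).symm
  have hρ0 : ∀ t v, 0 < t → 0 ≤ ρ t v := fun t v ht =>
    mul_nonneg (mul_nonneg ht.le (hpos t).le) (hr0 _)
  have hρ_le : ∀ t v, T ≤ t → v ∈ Ioo (0 : ℝ) 1 → ρ t v ≤ C₂ * (1 - v) ^ (γ - 1) :=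
    fun t v ht hv => hρ t (1 - v) ht (by linarith [hv.2]) (by linarith [hv.1])
  -- The second term is written with `v ^ 0` so that both are beta integrands.
  set G : ℝ → ℝ := fun v => C₁ * C₄ * C₂ * (v ^ (α - β) * (1 - v) ^ (γ - 1)) +
    B * C₂ * (v ^ (0 : ℝ) * (1 - v) ^ (γ - 1)) with hG
  have hGint : IntervalIntegrable G volume 0 1 :=
    ((intervalIntegrable_rpow_mul_one_sub_rpow (by linarith) (by linarith)).const_mul _).add
      ((intervalIntegrable_rpow_mul_one_sub_rpow (by linarith) (by linarith)).const_mul _)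
  have hG_le : ∀ t, T ≤ t → ∀ v ∈ Ioo (0 : ℝ) 1, ‖(m t v - B) * ρ t v‖ ≤ G v := by
    intro t ht v hv
    have ht0 := hT.trans_le ht
    rw [norm_mul, Real.norm_eq_abs, Real.norm_of_nonneg (hρ0 t v ht0)]
    have h1 : |m t v - B| ≤ C₁ * C₄ * v ^ (α - β) + B := by
      refine (abs_sub _ _).trans ?_
      rw [abs_of_pos hBpos]
      linarith [hm_le t v ht0 hv]
    have hv0 := hv.1
    calc |m t v - B| * ρ t v ≤ (C₁ * C₄ * v ^ (α - β) + B) * (C₂ * (1 - v) ^ (γ - 1)) :=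
          mul_le_mul h1 (hρ_le t v ht hv) (hρ0 t v ht0) (by positivity)
      _ = G v := by simp only [hG, Real.rpow_zero]; ring
  have hmeas : ∀ t, Measurable fun v => (m t v - B) * ρ t v := fun t => by
    simp only [hm, hρdef]
    fun_prop
  have hlim2 : Tendsto (fun t => ∫ v in (0 : ℝ)..1, (m t v - B) * ρ t v) atTop (𝓝 0) := by
    have e : (∫ _ in (0 : ℝ)..1, (0 : ℝ)) = 0 := by simp
    suffices h : Tendsto (fun t => ∫ v in (0 : ℝ)..1, (m t v - B) * ρ t v) atTop
        (𝓝 (∫ _ in (0 : ℝ)..1, (0 : ℝ))) by rwa [e] at h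
    refine intervalIntegral.tendsto_integral_filter_of_dominated_convergence G ?_ ?_ hGint ?_
    · exact Eventually.of_forall fun t => (hmeas t).aestronglyMeasurable
    · filter_upwards [eventually_ge_atTop T] with t ht using ae_uIoc_of_forall_mem_Ioo (hG_le t ht)
    · refine ae_uIoc_of_forall_mem_Ioo fun v hv => ?_
      have h1 : Tendsto (fun t => |m t v - B| * (C₂ * (1 - v) ^ (γ - 1))) atTop
          (𝓝 (|B - B| * (C₂ * (1 - v) ^ (γ - 1)))) :=
        (((hm_lim v hv).sub_const B).abs).mul_const _
      rw [sub_self, abs_zero, zero_mul] at h1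
      refine squeeze_zero_norm' ?_ h1
      filter_upwards [eventually_ge_atTop T] with t ht
      rw [norm_mul, Real.norm_eq_abs, Real.norm_of_nonneg (hρ0 t v (hT.trans_le ht))]
      exact mul_le_mul_of_nonneg_left (hρ_le t v ht hv) (abs_nonneg _)
  have hρint : ∀ t, ∫ v in (0 : ℝ)..1, ρ t v = l t * ∫ s in (0 : ℝ)..t, r s := by
    intro t
    have h1 : vconv (fun _ => 1) r t = ∫ s in (0 : ℝ)..t, r s := by
      rw [vconv_comm]; simp [vconv]
    rw [vconv_eq_mul_integral] at h1
    simp only [one_mul] at h1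
    simp only [hρdef]
    rw [intervalIntegral.integral_const_mul, ← h1]
    ring
  have hlim3 := (hlim1.sub hlim2).div_const B
  have e : (1 / α - 0) / B = 1 / (α * B) := by field_simp; simp
  rw [e] at hlim3
  refine hlim3.congr' ?_
  filter_upwards [eventually_ge_atTop T] with t ht
  have hi1 : IntervalIntegrable (fun v => (m t v - B) * ρ t v) volume 0 1 := by
    refine hGint.mono_fun (hmeas t).aestronglyMeasurable ?_
    rw [uIoc_of_le zero_le_one, ← restrict_Ioo_eq_restrict_Ioc]
    filter_upwards [ae_restrict_mem measurableSet_Ioo] with v hv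
    exact (hG_le t ht v hv).trans (le_abs_self _)
  have hi2 : IntervalIntegrable (fun v => B * ρ t v) volume 0 1 :=
    Continuous.intervalIntegrable (by simp only [hρdef]; fun_prop) _ _
  have h1 : ∫ v in (0 : ℝ)..1, m t v * ρ t v =
      (∫ v in (0 : ℝ)..1, (m t v - B) * ρ t v) + B * ∫ v in (0 : ℝ)..1, ρ t v := by
    rw [← intervalIntegral.integral_const_mul, ← intervalIntegral.integral_add hi1 hi2]
    refine intervalIntegral.integral_congr fun v _ => ?_
    ring
  rw [h1, hρint]
  field_simp
  ring

/-- Monotone density: the asymptotics of the primitive of a decreasing function `r`, measured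
against a function `l` of index `-α`, may be differentiated. -/
theorem tendsto_mul_mul_of_tendsto_mul_integral {l r : ℝ → ℝ} {α D : ℝ} (hpos : ∀ t, 0 < l t)
    (hreg : ∀ x, 0 < x → Tendsto (fun t => l (x * t) / l t) atTop (𝓝 (x ^ (-α))))
    (hrc : Continuous r) (hra : Antitone r)
    (hlim : Tendsto (fun t => l t * ∫ s in (0 : ℝ)..t, r s) atTop (𝓝 D)) :
    Tendsto (fun t => t * (l t * r t)) atTop (𝓝 (D * α)) := by
  set U : ℝ → ℝ := fun t => ∫ s in (0 : ℝ)..t, r s with hU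
  have hUx : ∀ x, 0 < x → Tendsto (fun t => (l t * U (x * t) - l t * U t) / (x - 1)) atTop
      (𝓝 (D * ((x ^ α - 1) / (x - 1)))) := by
    intro x hx
    have h1 : Tendsto (fun t => (l (x * t) * U (x * t)) / (l (x * t) / l t)) atTop
        (𝓝 (D / x ^ (-α))) :=
      (hlim.comp (tendsto_id.const_mul_atTop hx)).div (hreg x hx) (by positivity)
    have h2 := (h1.sub hlim).div_const (x - 1)
    have e : (D / x ^ (-α) - D) / (x - 1) = D * ((x ^ α - 1) / (x - 1)) := by
      rw [Real.rpow_neg hx.le, div_inv_eq_mul]; ring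
    rw [e] at h2
    refine h2.congr fun t => ?_
    have := hpos t
    have := hpos (x * t)
    simp only [hU]
    field_simp
  have hsub : ∀ a b, U b - U a = ∫ s in a..b, r s := fun a b =>
    intervalIntegral.integral_interval_sub_left (hrc.intervalIntegrable _ _)
      (hrc.intervalIntegrable _ _)
  have hslope : Tendsto (fun x : ℝ => D * ((x ^ α - 1) / (x - 1))) (𝓝[≠] 1) (𝓝 (D * α)) := by
    have h1 : HasDerivAt (fun x : ℝ => x ^ α) α 1 := by
      simpa using Real.hasDerivAt_rpow_const (x := 1) (p := α) (Or.inl one_ne_zero)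
    have h2 := (hasDerivAt_iff_tendsto_slope.1 h1).const_mul D
    refine h2.congr fun x => ?_
    rw [slope_def_field, Real.one_rpow]
  -- The secant bounds for `x > 1` and `x < 1` bracket `t * (l t * r t)`; let `x → 1`.
  rw [tendsto_order]
  constructor
  · intro a ha
    have h1 := (hslope.mono_left (nhdsWithin_mono 1 (s := Ioi (1 : ℝ))
      fun x hx => (mem_Ioi.1 hx).ne')).eventually_const_lt ha
    obtain ⟨x, hxa, hx⟩ := (h1.and (self_mem_nhdsWithin (s := Ioi (1 : ℝ)))).exists
    have hx1 : 1 < x := hx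
    filter_upwards [(hUx x (by linarith)).eventually_const_lt hxa, eventually_gt_atTop 0]
      with t ht ht0
    refine ht.trans_le ?_
    have h2 : U (x * t) - U t ≤ (x * t - t) * r t := by
      rw [hsub]
      calc ∫ s in t..(x * t), r s ≤ ∫ _ in t..(x * t), r t :=
            intervalIntegral.integral_mono_on (by nlinarith) (hrc.intervalIntegrable _ _)
              (by simp) fun s hs => hra hs.1
        _ = _ := by simp
    rw [div_le_iff₀ (by linarith)]
    calc l t * U (x * t) - l t * U t = l t * (U (x * t) - U t) := by ring
      _ ≤ l t * ((x * t - t) * r t) := mul_le_mul_of_nonneg_left h2 (hpos t).le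
      _ = _ := by ring
  · intro a ha
    have h1 := (hslope.mono_left (nhdsWithin_mono 1 (s := Iio (1 : ℝ))
      fun x hx => (mem_Iio.1 hx).ne)).eventually_lt_const ha
    have h0 : ∀ᶠ x in 𝓝[<] (1 : ℝ), 0 < x :=
      eventually_nhdsWithin_of_eventually_nhds (lt_mem_nhds one_pos)
    obtain ⟨x, ⟨hxa, hx0⟩, hx⟩ := ((h1.and h0).and (self_mem_nhdsWithin (s := Iio (1 : ℝ)))).exists
    have hx1 : x < 1 := hx
    filter_upwards [(hUx x hx0).eventually_lt_const hxa, eventually_gt_atTop 0] with t ht ht0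
    refine lt_of_le_of_lt ?_ ht
    have h2 : (t - x * t) * r t ≤ U t - U (x * t) := by
      rw [hsub]
      calc (t - x * t) * r t = ∫ _ in (x * t)..t, r t := by simp
        _ ≤ ∫ s in (x * t)..t, r s :=
            intervalIntegral.integral_mono_on (by nlinarith) (by simp)
              (hrc.intervalIntegrable _ _) fun s hs => hra hs.2
    rw [le_div_iff_of_neg (by linarith)]
    calc l t * U (x * t) - l t * U t = -(l t * (U t - U (x * t))) := by ring
      _ ≤ -(l t * ((t - x * t) * r t)) :=
        neg_le_neg (mul_le_mul_of_nonneg_left h2 (hpos t).le)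
      _ = _ := by ring

/-! ### Conclusion for the differential resolvent -/

theorem continuous_tailIntegral_max {k : ℝ → ℝ} (hk_cont : ContinuousOn k (Ici 0))
    (hk_int : IntegrableOn k (Ioi 0)) : Continuous fun t => tailIntegral k (max t 0) := by
  have hKc : Continuous fun t => k (max t 0) :=
    hk_cont.comp_continuous (by fun_prop) fun t => mem_Ici.2 (le_max_right _ _)
  have h : (fun t => tailIntegral k (max t 0)) =
      fun t => tailIntegral k 0 - ∫ s in (0 : ℝ)..(max t 0), k (max s 0) := by
    ext t
    rw [tailIntegral_eq_sub hk_int (le_max_right t 0)]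
    congr 1
    refine intervalIntegral.integral_congr fun s hs => ?_
    rw [uIcc_of_le (le_max_right t 0)] at hs
    simp only [max_eq_left hs.1]
  rw [h]
  exact continuous_const.sub ((intervalIntegral.continuous_primitive
    (fun a b => hKc.intervalIntegrable a b) 0).comp (by fun_prop))

theorem antitone_tailIntegral_max {k : ℝ → ℝ} (hk_pos : ∀ t : ℝ, 0 ≤ t → 0 < k t)
    (hk_int : IntegrableOn k (Ioi 0)) : Antitone fun t => tailIntegral k (max t 0) := by
  intro s t hst
  refine setIntegral_mono_set (hk_int.mono_set (Ioi_subset_Ioi (le_max_right s 0))) ?_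
    (Ioi_subset_Ioi (max_le_max_right 0 hst)).eventuallyLE
  filter_upwards [ae_restrict_mem measurableSet_Ioi] with x hx
  exact (hk_pos x ((le_max_right s 0).trans (mem_Ioi.1 hx).le)).le

theorem integrableOn_sq_of_le_rpow {r : ℝ → ℝ} {C T p : ℝ} (hrc : Continuous r)
    (hr0 : ∀ t, 0 ≤ r t) (hT : 0 < T) (hp : p < -1 / 2) (hle : ∀ t, T ≤ t → r t ≤ C * t ^ p) :
    IntegrableOn (fun t => r t ^ 2) (Ici 0) := by
  rw [← Icc_union_Ici_eq_Ici hT.le, integrableOn_union, integrableOn_Ici_iff_integrableOn_Ioi]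
  refine ⟨(Continuous.continuousOn (by fun_prop)).integrableOn_Icc, ?_⟩
  refine Integrable.mono' ((integrableOn_Ioi_rpow_of_lt (a := p * 2) (by linarith) hT).const_mul
    (C ^ 2)) (Continuous.aestronglyMeasurable (by fun_prop)) ?_
  filter_upwards [ae_restrict_mem measurableSet_Ioi] with t ht
  have ht0 : 0 < t := hT.trans ht
  rw [Real.norm_of_nonneg (sq_nonneg _)]
  calc r t ^ 2 ≤ (C * t ^ p) ^ 2 := pow_le_pow_left₀ (hr0 t) (hle t (mem_Ioi.1 ht).le) 2
    _ = C ^ 2 * t ^ (p * 2) := by rw [mul_pow, ← Real.rpow_mul_natCast ht0.le]; norm_num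

/-- Since `l` is bounded, `r t ≥ c / (2 * l 0 * t)` at infinity. -/
theorem not_integrableOn_of_tendsto_mul {l r : ℝ → ℝ} {c : ℝ} (hpos : ∀ t, 0 < l t)
    (hanti : Antitone l) (hc : 0 < c) (hr0 : ∀ t, 0 ≤ r t)
    (hlim : Tendsto (fun t => t * (l t * r t)) atTop (𝓝 c)) : ¬ IntegrableOn r (Ici 0) := by
  intro hint
  obtain ⟨T, hT⟩ := eventually_atTop.1
    ((hlim.eventually_const_lt (half_lt_self hc)).and (eventually_gt_atTop 0))
  have hT0 : 0 < T := (hT T le_rfl).2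
  have hl0 := hpos 0
  refine not_integrableOn_Ioi_inv (a := T) ?_
  refine Integrable.mono' ((hint.mono_set fun t ht => mem_Ici.2
    (hT0.trans (mem_Ioi.1 ht)).le).const_mul (2 * l 0 / c)) (by fun_prop) ?_
  filter_upwards [ae_restrict_mem measurableSet_Ioi] with t ht
  obtain ⟨h1, ht0⟩ := hT t (mem_Ioi.1 ht).le
  rw [Real.norm_of_nonneg (by positivity), div_mul_eq_mul_div, le_div_iff₀ hc,
    inv_mul_le_iff₀ ht0]
  have h2 : t * (l t * r t) ≤ t * (l 0 * r t) := by
    have := hanti ht0.le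
    have := hr0 t
    gcongr
  linarith

theorem mainTheorem1
    (a α : ℝ) (k L r : ℝ → ℝ)
    (hk_pos : ∀ t : ℝ, 0 ≤ t → 0 < k t)
    (hk_cont : ContinuousOn k (Ici 0))
    (hk_int : IntegrableOn k (Ioi 0))
    (ha : a + ∫ s in Ioi (0 : ℝ), k s = 0)
    (hlogconvex : ConvexOn ℝ (Ici 0) (fun t : ℝ => Real.log (tailIntegral k t)))
    (hα_pos : 0 < α) (hα_lt : α < 1)
    (hL : IsSlowlyVarying L)
    (htail : ∀ t : ℝ, 0 < t → tailIntegral k t = L t * t ^ (-α))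
    (hr : IsDifferentialResolvent a k r) :
    Tendsto (fun t : ℝ => r t * t ^ (1 - α) * L t) atTop
        (𝓝 (Real.sin (α * Real.pi) / Real.pi)) ∧
      (α < 1 / 2 →
        (∀ t : ℝ, 0 ≤ t → 0 < r t) ∧
        MemLp r 2 (volume.restrict (Ici (0 : ℝ))) ∧
        ¬ MemLp r 1 (volume.restrict (Ici (0 : ℝ)))) := by
  obtain ⟨R, hRc, hRint, hReq⟩ := hr.exists_resolvent hk_cont hk_int ha
  set l : ℝ → ℝ := fun t => tailIntegral k (max t 0) with hl
  set ρ : ℝ → ℝ := fun t => r (max t 0) with hρ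
  have hl_eq : ∀ t, 0 ≤ t → l t = tailIntegral k t := fun t ht => by simp only [hl, max_eq_left ht]
  have hρ_eq : ∀ t, 0 ≤ t → ρ t = r t := fun t ht => by simp only [hρ, max_eq_left ht]
  have hlc : Continuous l := continuous_tailIntegral_max hk_cont hk_int
  have hla : Antitone l := antitone_tailIntegral_max hk_pos hk_int
  have hpos : ∀ t, 0 < l t := by
    intro t
    have hm : 0 < max t 1 := lt_max_of_lt_right one_pos
    refine lt_of_lt_of_le ?_ (hla (le_max_left t 1))
    rw [hl_eq _ hm.le, htail _ hm]
    exact mul_pos (hL.pos _ hm) (Real.rpow_pos_of_pos hm _)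
  have hconv : ConvexOn ℝ (Ici 0) (fun t => Real.log (l t)) :=
    hlogconvex.congr fun t ht => by simp only [hl_eq t ht]
  have hReq' : ∀ t, 0 ≤ t → R t + ∫ s in (0 : ℝ)..t, l (t - s) * R s = l t := fun t ht => by
    rw [hl_eq t ht, ← hReq t ht]
  have hRpos := pos_of_add_integral_eq hpos hlc hla hconv hRc hReq'
  have hρc : Continuous ρ :=
    hr.continuousOn.comp_continuous (by fun_prop) fun t => mem_Ici.2 (le_max_right _ _)
  have hρ_int : ∀ t, 0 ≤ t → ∫ s in (0 : ℝ)..t, R s = 1 - ρ t := fun t ht => by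
    rw [hρ_eq t ht, hRint t ht]
  have hr_pos : ∀ t, 0 ≤ t → 0 < r t := fun t ht => by
    have := integral_lt_one_of_add_integral_eq hpos hlc hla hRc hRpos hReq' ht
    rw [hRint t ht] at this
    linarith
  have hρ0 : ∀ t, 0 ≤ ρ t := fun t => (hr_pos _ (le_max_right _ _)).le
  have hρa : Antitone ρ := by
    intro s t hst
    have hs : 0 ≤ max s 0 := le_max_right _ _
    have h1 : 0 ≤ ∫ x in (max s 0)..(max t 0), R x :=
      intervalIntegral.integral_nonneg (max_le_max_right 0 hst)
        fun x hx => (hRpos x (hs.trans hx.1)).le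
    rw [← intervalIntegral.integral_interval_sub_left (hRc.intervalIntegrable 0 _)
      (hRc.intervalIntegrable 0 _), hRint _ (le_max_right _ _), hRint _ hs] at h1
    simp only [hρ]
    linarith
  have hρ1 : ∀ t, ρ t ≤ 1 := fun t => by
    have h1 : ρ (max t 0) ≤ ρ 0 := hρa (le_max_right _ _)
    rw [hρ_eq 0 le_rfl, hr.initial, hρ_eq _ (le_max_right _ _)] at h1
    exact h1
  have heq : ∀ t, 0 ≤ t → ρ t + vconv l ρ t = 1 := fun t ht =>
    add_vconv_eq_one hpos hlc hRc (fun t ht => hRpos t ht)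
      (fun t ht => by
        rw [vconv_comm, ← hReq' t ht, vconv]
        congr 1
        exact intervalIntegral.integral_congr fun s _ => mul_comm _ _) hρ_int ht
  have hreg : ∀ x, 0 < x → Tendsto (fun t => l (x * t) / l t) atTop (𝓝 (x ^ (-α))) := by
    intro x hx
    have h1 := (hL.tendsto x hx).mul_const (x ^ (-α))
    rw [one_mul] at h1
    refine h1.congr' ?_
    filter_upwards [eventually_gt_atTop 0] with t ht
    have hxt : 0 < x * t := mul_pos hx ht
    rw [hl_eq _ hxt.le, hl_eq _ ht.le, htail _ hxt, htail _ ht, Real.mul_rpow hx.le ht.le]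
    have := hL.pos t ht
    have : 0 < t ^ (-α) := Real.rpow_pos_of_pos ht _
    field_simp
  have hsin : 0 < Real.sin (Real.pi * α) :=
    Real.sin_pos_of_pos_of_lt_pi (by positivity) (by nlinarith [Real.pi_pos])
  have hlim : Tendsto (fun t => t * (l t * ρ t)) atTop (𝓝 (Real.sin (α * Real.pi) / Real.pi)) := by
    have h1 := tendsto_mul_mul_of_tendsto_mul_integral hpos hreg hρc hρa
      (tendsto_mul_integral hpos hlc hla hα_pos hα_lt hreg hρc hρ0 hρ1 hρa heq)
    have e : 1 / (α * (Real.pi / Real.sin (Real.pi * α))) * α =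
        Real.sin (α * Real.pi) / Real.pi := by
      rw [mul_comm α Real.pi]
      field_simp
    rwa [e] at h1
  have hae : ρ =ᵐ[volume.restrict (Ici (0 : ℝ))] r := by
    filter_upwards [ae_restrict_mem measurableSet_Ici] with t ht using hρ_eq t ht
  refine ⟨hlim.congr' ?_, fun hα => ⟨hr_pos, ?_, ?_⟩⟩
  · filter_upwards [eventually_gt_atTop 0] with t ht
    rw [hl_eq t ht.le, hρ_eq t ht.le, htail t ht, sub_eq_add_neg, Real.rpow_add ht, Real.rpow_one]
    ring
  · obtain ⟨C, T, hT, hle⟩ := exists_le_rpow_of_mul_mul_le_one (r := ρ) (β := (α + 1 / 2) / 2)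
      hpos hla (by linarith) (by linarith) (hreg 2 two_pos)
      fun t ht => mul_mul_le_one hpos hlc hla hρc hρ0 hρa heq ht
    rw [← memLp_congr_ae hae, memLp_two_iff_integrable_sq hρc.aestronglyMeasurable]
    exact integrableOn_sq_of_le_rpow hρc hρ0 hT (by linarith) hle
  · rw [← memLp_congr_ae hae, memLp_one_iff_integrable]
    exact not_integrableOn_of_tendsto_mul hpos hla
      (div_pos (by rwa [mul_comm]) Real.pi_pos) hρ0 hlim
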